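/- **Definitions (ZFC).** For a cardinal $\kappa$ and a set $X$ let $P_\kappa(X)=\{A\subseteq X: |A|<\kappa\}$. An ultrafilter $U$ on $P_\kappa(X)$ is *fine* if $\{A\in P_\kappa(X): x\in A\}\in U$ for every $x\in X$; it is *$\kappa$-complete* if the intersection of fewer than $\kappa$ many sets in $U$ is in $U$; it is *normal* if every function $f$ that is defined on a set in $U$ and satisfies $f(A)\in A$ for all $A$ in its domain is constant on a set in $U$. An uncountable cardinal $\kappa$ is *strongly compact* if for every set $X$ there is a fine $\kappa$-complete ultrafilter on $P_\kappa(X)$, and *supercompact* if for every set $X$ there is a normal fine $\kappa$-complete ultrafilter on $P_\kappa(X)$. A *graph* is a pair $\langle G,E\rangle$ of a set $G$ and a binary relation $E$ on $G$; a *homomorphism* $\langle G,E\rangle\to\langle G',E'\rangle$ is a function $h:G\to G'$ such that $\langle v,w\rangle\in E$ implies $\langle h(v),h(w)\rangle\in E'$. *Semi-Weak Vopěnka's Principle* (SWVP) is the following statement of second-order set theory: there is no sequence (class function) $\langle G_\alpha:\alpha\in\mathrm{Ord}\rangle$ of graphs such that whenever $\alpha\le\alpha'$ there is a homomorphism $G_{\alpha'}\to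 G_\alpha$, and whenever $\alpha<\alpha'$ there is no homomorphism $G_\alpha\to G_{\alpha'}$. The structure $\langle V_{\kappa+1},\in\rangle$ is regarded as a structure for second-order set theory: all its elements are its classes, and those that belong to some element of it (the elements of $V_\kappa$) are its sets. GB + AC is Gödel–Bernays set theory with the Axiom of Choice for sets. **Theorem.** If $\kappa$ is both the least supercompact cardinal and the least strongly compact cardinal, then the structure $\langle V_{\kappa+1},\in\rangle$ satisfies SWVP and the statement "there is no strongly compact cardinal." Moreover, $\langle V_{\kappa+1},\in\rangle$ is a model of GB + AC. Hence, if there is such a cardinal $\kappa$, then over GB + AC the principle SWVP does not imply the existence of a strongly compact cardinal: not every structure that satisfies GB + AC and SWVP satisfies "there is a strongly compact cardinal." -/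

import Mathlib

open scoped Cardinal ZFSet

universe u v

/-! ## Strongly compact and supercompact cardinals

The sets of the ambient universe are the types in `Type u`; the corresponding cardinals are the
elements of `Cardinal.{u}`, and the corresponding cumulative hierarchy lives in `ZFSet.{u}`. -/

/-- The set of all subsets of `X` of cardinality less than `κ`. -/
abbrev SmallSubsets (κ : Cardinal.{u}) (X : Type u) : Type u := {A : Set X // #A < κ}

/-- Fineness: for every `x : X`, the set of all `A` with `x ∈ A` is in the ultrafilter. -/
def IsFineUltrafilter {κ : Cardinal.{u}} {X : Type u} (U : Ultrafilter (SmallSubsets κ X)) : Prop :=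
  ∀ x : X, {A : SmallSubsets κ X | x ∈ A.1} ∈ U

/-- Normality: every choice function defined on a set in the ultrafilter is constant on a set in
the ultrafilter. -/
def IsNormalUltrafilter {κ : Cardinal.{u}} {X : Type u}
    (U : Ultrafilter (SmallSubsets κ X)) : Prop :=
  ∀ S ∈ U, ∀ f : S → X, (∀ A : S, f A ∈ A.1.1) →
    ∃ x : X, {A : SmallSubsets κ X | ∃ h : A ∈ S, f ⟨A, h⟩ = x} ∈ U

/-- There is a fine `κ`-complete ultrafilter on the set of subsets of `X` of size less than `κ`. -/
def IsCompactFor (κ : Cardinal.{u}) (X : Type u) : Prop :=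
  ∃ U : Ultrafilter (SmallSubsets κ X),
    CardinalInterFilter (U : Filter (SmallSubsets κ X)) κ ∧ IsFineUltrafilter U

/-- There is a normal fine `κ`-complete ultrafilter on the set of subsets of `X` of size less than
`κ`. -/
def IsSupercompactFor (κ : Cardinal.{u}) (X : Type u) : Prop :=
  ∃ U : Ultrafilter (SmallSubsets κ X),
    CardinalInterFilter (U : Filter (SmallSubsets κ X)) κ ∧ IsFineUltrafilter U ∧
      IsNormalUltrafilter U

/-- `κ` is a strongly compact cardinal (of the ambient universe). -/
def IsStronglyCompact (κ : Cardinal.{u}) : Prop :=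
  ℵ₀ < κ ∧ ∀ X : Type u, IsCompactFor κ X

/-- `κ` is a supercompact cardinal (of the ambient universe). -/
def IsSupercompact (κ : Cardinal.{u}) : Prop :=
  ℵ₀ < κ ∧ ∀ X : Type u, IsSupercompactFor κ X

/-! ## The structure `⟨V_o, ∈⟩` -/

/-- The underlying set of the structure `⟨V_o, ∈⟩`: its elements are the elements of `V_o`. -/
@[ext]
structure VStructure (o : Ordinal.{u}) : Type (u + 1) where
  val : ZFSet.{u}
  property : val ∈ V_ o

/-- The membership relation of the structure `⟨V_o, ∈⟩` is the true membership relation. -/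
instance (o : Ordinal.{u}) : Membership (VStructure o) (VStructure o) :=
  ⟨fun y x => x.val ∈ y.val⟩

/-! ## Formulas of set theory, interpreted in a structure

Below, `M` is an arbitrary structure with one binary relation, written `∈`. Every definition is the
interpretation in `M` of a formula in the language of second-order set theory: all quantifiers
range over elements of `M`, and the only atomic formulas are `x ∈ y` and `x = y`. The elements of
`M` are the classes of the model, and the sets of the model are those classes that belong to some
class. -/

namespace SetModel

variable {M : Type v} [Membership M M]

/-- The class `x` is a set. -/
def IsSet (x : M) : Prop := ∃ y : M, x ∈ y

def Sub (x y : M) : Prop := ∀ z : M, z ∈ x → z ∈ y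

/-- `z = {a, b}`. -/
def IsUPair (z a b : M) : Prop := ∀ w : M, w ∈ z ↔ w = a ∨ w = b

/-- `p = ⟨a, b⟩`, the Kuratowski ordered pair `{{a}, {a, b}}`. -/
def IsOPair (p a b : M) : Prop :=
  ∃ s t : M, IsUPair s a a ∧ IsUPair t a b ∧ IsUPair p s t

/-- `⟨a, b⟩ ∈ f`. -/
def PairMem (a b f : M) : Prop := ∃ p : M, p ∈ f ∧ IsOPair p a b

/-- `f ⊆ a × b`. -/
def IsRel (f a b : M) : Prop :=
  ∀ p : M, p ∈ f → ∃ x y : M, x ∈ a ∧ y ∈ b ∧ IsOPair p x y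

/-- `f` is a function from `a` to `b`. -/
def IsFun (f a b : M) : Prop :=
  IsRel f a b ∧ ∀ x : M, x ∈ a → ∃! y : M, PairMem x y f

/-- `f` is a bijection from `a` to `b`. -/
def IsBij (f a b : M) : Prop :=
  IsFun f a b ∧ ∀ y : M, y ∈ b → ∃! x : M, PairMem x y f

/-- The sets `a` and `b` have the same cardinality. -/
def Equinumerous (a b : M) : Prop := ∃ f : M, IsSet f ∧ IsBij f a b

/-- `a` is an ordinal: a transitive set of transitive sets. -/
def IsOrd (a : M) : Prop :=
  IsSet a ∧ (∀ x : M, x ∈ a → Sub x a) ∧ ∀ x : M, x ∈ a → ∀ y : M, y ∈ x → Sub y x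

/-- `a` is a nonzero limit ordinal. -/
def IsLimitOrd (a : M) : Prop :=
  IsOrd a ∧ (∃ x : M, x ∈ a) ∧ ∀ x : M, x ∈ a → ∃ y : M, y ∈ a ∧ x ∈ y

/-- `w` is the least nonzero limit ordinal, `ω`. -/
def IsOmega (w : M) : Prop := IsLimitOrd w ∧ ∀ n : M, n ∈ w → ¬ IsLimitOrd n

/-- `k` is a cardinal: an ordinal not equinumerous with any smaller ordinal. -/
def IsCard (k : M) : Prop := IsOrd k ∧ ∀ a : M, a ∈ k → ¬ Equinumerous a k

/-- `k` is an uncountable cardinal, that is, a cardinal larger than `ω`. -/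
def IsUncountableCard (k : M) : Prop := IsCard k ∧ ∃ w : M, IsOmega w ∧ w ∈ k

/-- The set `x` has cardinality less than the cardinal `k`. -/
def CardLT (x k : M) : Prop := ∃ a : M, a ∈ k ∧ Equinumerous x a

/-- `P` is the set of all subsets of `X` of cardinality less than `k`. -/
def IsSmallSubsets (P k X : M) : Prop :=
  IsSet P ∧ ∀ a : M, a ∈ P ↔ IsSet a ∧ Sub a X ∧ CardLT a k

/-- `U` is an ultrafilter on the set `P` that is `k`-complete: the intersection of fewer than `k`
many sets in `U` is in `U`. Here `k` is always an uncountable cardinal, so this includes closure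
under intersections of two sets. -/
structure IsCompleteUltrafilter (U P k : M) : Prop where
  isSet : IsSet U
  sub : ∀ S : M, S ∈ U → Sub S P
  whole : P ∈ U
  proper : ∀ S : M, S ∈ U → ∃ a : M, a ∈ S
  upward : ∀ S T : M, S ∈ U → Sub S T → Sub T P → T ∈ U
  ultra : ∀ S : M, IsSet S → Sub S P →
    S ∈ U ∨ ∃ T : M, T ∈ U ∧ ∀ a : M, a ∈ T ↔ a ∈ P ∧ ¬ a ∈ S
  complete : ∀ A : M, IsSet A → Sub A U → CardLT A k →
    ∃ T : M, T ∈ U ∧ ∀ a : M, a ∈ T ↔ a ∈ P ∧ ∀ S : M, S ∈ A → a ∈ S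

/-- `U`, an ultrafilter on the set `P` of subsets of `X` of cardinality less than some cardinal, is
fine: for every `x ∈ X`, the set `{a ∈ P : x ∈ a}` is in `U`. -/
def IsFine (U P X : M) : Prop :=
  ∀ x : M, x ∈ X → ∃ T : M, T ∈ U ∧ ∀ a : M, a ∈ T ↔ a ∈ P ∧ x ∈ a

/-- `k` is a strongly compact cardinal in the sense of `M`. -/
def IsStronglyCompactIn (k : M) : Prop :=
  IsUncountableCard k ∧ ∀ X : M, IsSet X →
    ∃ P U : M, IsSmallSubsets P k X ∧ IsCompleteUltrafilter U P k ∧ IsFine U P X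

/-- `g` is the graph `⟨v, e⟩`, where `v` is a set and `e` is a binary relation on `v`. -/
def IsGraphWith (g v e : M) : Prop := IsOPair g v e ∧ IsRel e v v

/-- `g` is a graph. -/
def IsGraph (g : M) : Prop := ∃ v e : M, IsGraphWith g v e

/-- `h` is a homomorphism from the graph `g` to the graph `g'`. -/
def IsGraphHom (h g g' : M) : Prop :=
  ∃ v e v' e' : M, IsGraphWith g v e ∧ IsGraphWith g' v' e' ∧ IsFun h v v' ∧
    ∀ x y x' y' : M, PairMem x y e → PairMem x x' h → PairMem y y' h → PairMem x' y' e'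

/-- There is a homomorphism from the graph `g` to the graph `g'`. -/
def HomExists (g g' : M) : Prop := ∃ h : M, IsSet h ∧ IsGraphHom h g g'

/-- The class `F` is a sequence `⟨G_α : α ∈ Ord⟩` of graphs: a class function that has the class of
all ordinals as its domain and all of whose values are graphs. -/
def IsGraphSequence (F : M) : Prop :=
  (∀ p : M, p ∈ F → ∃ α g : M, IsOrd α ∧ IsGraph g ∧ IsOPair p α g) ∧
    ∀ α : M, IsOrd α → ∃! g : M, PairMem α g F

variable (M)

/-- `M` satisfies "there is a strongly compact cardinal". -/
def SatisfiesExistsStronglyCompact : Prop := ∃ k : M, IsStronglyCompactIn k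

/-- `M` satisfies Semi-Weak Vopěnka's Principle: there is no sequence `⟨G_α : α ∈ Ord⟩` of graphs
such that there is a homomorphism from `G_β` to `G_α` whenever `α ≤ β`, and there is no
homomorphism from `G_α` to `G_β` whenever `α < β`. -/
def SatisfiesSWVP : Prop :=
  ¬ ∃ F : M, IsGraphSequence F ∧
    (∀ α β g g' : M, IsOrd α → IsOrd β → PairMem α g F → PairMem β g' F →
      (α ∈ β ∨ α = β) → HomExists g' g) ∧
    (∀ α β g g' : M, IsOrd α → IsOrd β → PairMem α g F → PairMem β g' F →
      α ∈ β → ¬ HomExists g g')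

end SetModel

/-! ## Gödel–Bernays set theory with the Axiom of Choice for sets -/

/-- First-order formulas in the language `∈, =`, with variables indexed by natural numbers and with
quantification over sets only; their free variables may stand for classes. -/
inductive ClassFormula : Type
  | mem (i j : ℕ) : ClassFormula
  | eq (i j : ℕ) : ClassFormula
  | neg (φ : ClassFormula) : ClassFormula
  | and (φ ψ : ClassFormula) : ClassFormula
  | allSets (i : ℕ) (φ : ClassFormula) : ClassFormula

/-- Truth of a formula in `M` under an assignment of elements of `M` to the variables. -/
def ClassFormula.Holds {M : Type v} [Membership M M] : ClassFormula → (ℕ → M) → Prop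
  | .mem i j, a => a i ∈ a j
  | .eq i j, a => a i = a j
  | .neg φ, a => ¬ φ.Holds a
  | .and φ ψ, a => φ.Holds a ∧ ψ.Holds a
  | .allSets i φ, a => ∀ x : M, SetModel.IsSet x → φ.Holds (Function.update a i x)

namespace SetModel

/-- `M` satisfies the axioms of Gödel–Bernays set theory with the Axiom of Choice for sets. -/
structure SatisfiesGBAC (M : Type v) [Membership M M] : Prop where
  extensionality : ∀ X Y : M, (∀ z : M, z ∈ X ↔ z ∈ Y) → X = Y
  /-- The sets satisfying a given formula, with class parameters, form a class. -/
  comprehension : ∀ (φ : ClassFormula) (a : ℕ → M),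
    ∃ C : M, ∀ x : M, x ∈ C ↔ IsSet x ∧ φ.Holds (Function.update a 0 x)
  /-- Every nonempty class has an element that is disjoint from it. -/
  foundation : ∀ X : M, (∃ x : M, x ∈ X) → ∃ x : M, x ∈ X ∧ ∀ z : M, z ∈ x → ¬ z ∈ X
  pairing : ∀ a b : M, IsSet a → IsSet b → ∃ z : M, IsSet z ∧ IsUPair z a b
  union : ∀ a : M, IsSet a → ∃ z : M, IsSet z ∧ ∀ x : M, x ∈ z ↔ ∃ y : M, y ∈ a ∧ x ∈ y
  powerset : ∀ a : M, IsSet a → ∃ z : M, IsSet z ∧ ∀ x : M, x ∈ z ↔ IsSet x ∧ Sub x a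
  infinity : ∃ w : M, IsSet w ∧ (∃ e : M, e ∈ w ∧ ∀ z : M, ¬ z ∈ e) ∧
    ∀ x : M, x ∈ w → ∃ y : M, y ∈ w ∧ ∀ z : M, z ∈ y ↔ z ∈ x ∨ z = x
  /-- The image of a set under a (possibly partial) class function is a set. -/
  replacement : ∀ F a : M, IsSet a →
    (∀ x y y' : M, PairMem x y F → PairMem x y' F → y = y') →
    ∃ b : M, IsSet b ∧ ∀ y : M, y ∈ b ↔ ∃ x : M, x ∈ a ∧ PairMem x y F
  /-- Every set of nonempty sets has a choice function. -/
  choice : ∀ a : M, IsSet a → (∀ x : M, x ∈ a → ∃ y : M, y ∈ x) →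
    ∃ f : M, IsSet f ∧ (∀ p : M, p ∈ f → ∃ x y : M, x ∈ a ∧ y ∈ x ∧ IsOPair p x y) ∧
      ∀ x : M, x ∈ a → ∃! y : M, PairMem x y f

end SetModel

/-!
Let `κ` be the least strongly compact cardinal, and suppose that it is supercompact. It is
inaccessible, so `V_{κ+1}` satisfies Gödel–Bernays set theory with choice for sets.

Given a `κ`-sequence of graphs `G i` in `V_κ` with homomorphisms from later to earlier ones, let
`j` be the ultrapower by a normal fine ultrafilter on the small subsets of `κ ⊔ ∏ i, G i`, and let
`G*` be the image of the sequence under `j`. The downward homomorphisms on `G* κ` yield a map from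
`G* κ` to `∏ i < κ, G i`; composed with `j` and the projection to the coordinate `κ + 1`, it is a
map from `G* κ` to `G* (κ + 1)`. If it failed to preserve an edge, then by elementarity some
coordinate `i < κ` would already witness the failure. Hence `G* κ` has a homomorphism to
`G* (κ + 1)`, and elementarity reflects this to a pair of graphs of the original sequence. The
ultrapower itself is not needed: it suffices to have one small subset `A` that behaves like
`j '' (κ ⊔ ∏ i, G i)`, with the supremum of its ordinals in the role of `κ`.

If `V_{κ+1}` believed that `μ < κ` is strongly compact, then integrating the ultrafilters for
`μ`-small subsets of the sets in `V_κ` along an ultrafilter witnessing the strong compactness of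
`κ` would make `μ` strongly compact, contradicting the minimality of `κ`.
-/

section Ultrafilters

open Filter

variable {κ μ : Cardinal.{u}} {X : Type u}

section SmallSubsets

variable {U : Ultrafilter (SmallSubsets κ X)}

theorem IsFineUltrafilter.eventually_subset [CardinalInterFilter U.toFilter κ]
    (hU : IsFineUltrafilter U) {B : Set X} (hB : #B < κ) : ∀ᶠ A in U.toFilter, B ⊆ A.1 :=
  (eventually_cardinal_ball (p := fun (A : SmallSubsets κ X) x _ => x ∈ A.1) hB).2 fun x _ => hU x

theorem IsNormalUltrafilter.exists_eventually (hU : IsNormalUltrafilter U)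
    {p : SmallSubsets κ X → X → Prop} (h : ∀ᶠ A in U.toFilter, ∃ x ∈ A.1, p A x) :
    ∃ x, ∀ᶠ A in U.toFilter, p A x := by
  obtain ⟨x, hx⟩ := hU {A | ∃ x ∈ A.1, p A x} h (fun A => A.2.choose) (fun A => A.2.choose_spec.1)
  refine ⟨x, mem_of_superset hx ?_⟩
  rintro A ⟨hA, rfl⟩
  exact hA.choose_spec.2

/-- Closure of a normal ultrafilter under diagonal intersections. -/
theorem IsNormalUltrafilter.eventually_forall_mem (hU : IsNormalUltrafilter U) {ι : Type*}
    {f : ι → X} (hf : f.Injective) {p : SmallSubsets κ X → ι → Prop}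
    (h : ∀ i, ∀ᶠ A in U.toFilter, p A i) : ∀ᶠ A in U.toFilter, ∀ i, f i ∈ A.1 → p A i := by
  by_contra hcon
  have hbad : ∀ᶠ A in U.toFilter, ∃ x ∈ A.1, ∃ i, f i = x ∧ ¬p A i := by
    filter_upwards [Ultrafilter.eventually_not.2 hcon] with A hA
    push Not at hA
    obtain ⟨i, hi, hp⟩ := hA
    exact ⟨f i, hi, i, rfl, hp⟩
  obtain ⟨x, hx⟩ := hU.exists_eventually hbad
  obtain ⟨-, i, rfl, -⟩ := hx.exists
  obtain ⟨A, ⟨j, hji, hj⟩, hi⟩ := (hx.and (h i)).exists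
  exact hj (hf hji ▸ hi)

theorem IsNormalUltrafilter.eventually_exists_mem_of_exists (hU : IsNormalUltrafilter U)
    (hfine : IsFineUltrafilter U) {ι α : Type*} (f : ι → X) {r : α → X} (hr : r.Injective)
    (R : α → α → ι → Prop) :
    ∀ᶠ A in U.toFilter, ∀ c, r c ∈ A.1 → ∀ d, r d ∈ A.1 →
      (∃ i, R c d i) → ∃ i, f i ∈ A.1 ∧ R c d i := by
  refine hU.eventually_forall_mem hr fun c => hU.eventually_forall_mem hr fun d => ?_
  by_cases hcd : ∃ i, R c d i
  · obtain ⟨i, hi⟩ := hcd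
    filter_upwards [hfine (f i)] with A hA _ using ⟨i, hA, hi⟩
  · exact .of_forall fun A h => (hcd h).elim

theorem IsNormalUltrafilter.eventually_exists_mem_iff_lt [CardinalInterFilter U.toFilter κ]
    (hU : IsNormalUltrafilter U) (hfine : IsFineUltrafilter U) {ι : Type u} [LinearOrder ι]
    [WellFoundedLT ι] (hι : κ ≤ #ι) (hIio : ∀ i : ι, #(Set.Iio i) < κ) {f : ι → X}
    (hf : f.Injective) : ∀ᶠ A in U.toFilter, ∃ δ, ∀ i, f i ∈ A.1 ↔ i < δ := by
  have hlower : ∀ᶠ A in U.toFilter, ∀ i, f i ∈ A.1 → f '' Set.Iio i ⊆ A.1 :=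
    hU.eventually_forall_mem hf fun i =>
      hfine.eventually_subset (Cardinal.mk_image_le.trans_lt (hIio i))
  filter_upwards [hlower] with A hA
  have hset : IsLowerSet (f ⁻¹' A.1) := fun i j hji hi =>
    hji.eq_or_lt.elim (· ▸ hi) fun hlt => hA i hi ⟨j, hlt, rfl⟩
  rcases hset.eq_univ_or_Iio with huniv | ⟨δ, hδ⟩
  · have hle : #ι ≤ #A.1 :=
      Cardinal.mk_le_of_injective (f := fun i => ⟨f i, huniv.ge (Set.mem_univ i)⟩)
        fun i j hij => hf (congrArg Subtype.val hij)
    exact ((hι.trans hle).not_gt A.2).elim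
  · exact ⟨δ, fun i => Set.ext_iff.1 hδ i⟩

end SmallSubsets

theorem exists_eventually_eq_of_card_lt {α β : Type u} (D : Ultrafilter α)
    [CardinalInterFilter D.toFilter κ] (hβ : #β < κ) (f : α → β) :
    ∃ b, ∀ᶠ a in D.toFilter, f a = b := by
  by_contra! hne
  obtain ⟨a, ha⟩ := ((eventually_cardinal_forall hβ (p := fun a b => f a ≠ b)).2 hne).exists
  exact ha _ rfl

/-- In terms of the ultrapower `j` by `U`, the statement is that `j '' ∏ i, V i` exhausts the
restrictions of threads to `j '' ι`: completeness fixes each coordinate and normality fixes all of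
them simultaneously. -/
theorem IsNormalUltrafilter.eventually_forall_exists_mem_eqOn {U : Ultrafilter (SmallSubsets κ X)}
    [CardinalInterFilter U.toFilter κ] (hU : IsNormalUltrafilter U) (hfine : IsFineUltrafilter U)
    {ι : Type*} {V : ι → Type u} (hV : ∀ i, #(V i) < κ) {f : ι → X} (hf : f.Injective)
    (r : (∀ i, V i) → X) :
    ∀ᶠ A in U.toFilter, ∀ s : ∀ i, V i, ∃ c, r c ∈ A.1 ∧ ∀ i, f i ∈ A.1 → c i = s i := by
  by_contra hcon
  have hbad : ∀ᶠ A in U.toFilter, ∃ s : ∀ i, V i, ∀ c, r c ∈ A.1 → ∃ i, f i ∈ A.1 ∧ c i ≠ s i := by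
    filter_upwards [Ultrafilter.eventually_not.2 hcon] with A hA
    push Not at hA
    exact hA
  have : Nonempty (∀ i, V i) := hbad.exists.elim fun _ ⟨s, _⟩ => ⟨s⟩
  obtain ⟨s, hs⟩ := hbad.choice
  choose c hc using fun i => exists_eventually_eq_of_card_lt U (hV i) fun A => s A i
  have hrc : ∀ᶠ A in U.toFilter, r c ∈ A.1 := hfine (r c)
  obtain ⟨A, hsA, hcA, heq⟩ := (hs.and (hrc.and (hU.eventually_forall_mem hf hc))).exists
  obtain ⟨i, hi, hne⟩ := hsA c hcA
  exact hne (heq i hi).symm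

theorem IsCompactFor.le_cof_ord (h : IsCompactFor κ κ.ord.ToType) (hκ : ℵ₀ ≤ κ) :
    κ ≤ κ.ord.cof := by
  obtain ⟨U, _, hfine⟩ := h
  obtain ⟨S, hcofinal, hcard⟩ := Order.exists_cof_eq (α := κ.ord.ToType)
  rw [Ordinal.cof_toType] at hcard
  rw [← hcard]
  by_contra! hlt
  have hIic : ∀ s ∈ S, ∀ᶠ A in U.toFilter, Set.Iic s ⊆ A.1 := fun s _ =>
    hfine.eventually_subset (by simpa using Cardinal.mk_Iic_lt s (by simp) (by simpa using hκ))
  obtain ⟨A, hA⟩ := ((eventually_cardinal_ball hlt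
    (p := fun (A : SmallSubsets κ _) s _ => Set.Iic s ⊆ A.1)).2 hIic).exists
  have huniv : A.1 = Set.univ := Set.eq_univ_of_forall fun x => by
    obtain ⟨s, hs, hxs⟩ := hcofinal x
    exact hA s hs hxs
  simpa [huniv] using A.2

theorem IsCompactFor.isStrongPrelimit (h : IsCompactFor κ X) (hX : #X = κ) :
    κ.IsStrongPrelimit := by
  obtain ⟨U, _, hfine⟩ := h
  intro μ hμ
  induction μ using Cardinal.inductionOn with | mk I
  by_contra! hle
  obtain ⟨e⟩ : #X ≤ #(Set I) := by simpa [hX] using hle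
  have hne (A : SmallSubsets κ X) : ∃ x, x ∉ A.1 := by
    by_contra! hA
    simpa [Set.eq_univ_of_forall hA, hX] using A.2
  choose g hg using hne
  have hdecided (i : I) : ∃ b : Prop, ∀ᶠ A in U.toFilter, (i ∈ e (g A)) = b := by
    rcases U.em fun A => i ∈ e (g A) with h | h
    · exact ⟨True, h.mono fun A hA => eq_true hA⟩
    · exact ⟨False, h.mono fun A hA => eq_false hA⟩
  choose b hb using hdecided
  have hconst : ∀ᶠ A in U.toFilter, ∀ i, (i ∈ e (g A)) = b i := (eventually_cardinal_forall hμ).2 hb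
  obtain ⟨A, hA⟩ := hconst.exists
  obtain ⟨B, hB, hgB⟩ := (hconst.and (hfine (g A))).exists
  have heq : g B = g A := e.injective <| Set.ext fun i => by rw [hB i, hA i]
  exact hg B (heq ▸ hgB)

theorem IsStronglyCompact.isInaccessible (h : IsStronglyCompact κ) : κ.IsInaccessible :=
  ⟨h.1, (h.2 _).le_cof_ord h.1.le, (h.2 κ.ord.ToType).isStrongPrelimit (by simp)⟩

/-- The ultrafilter on the `μ`-small subsets of `X` is the limit, along the one on the `κ`-small
subsets `A` of `X`, of those on the `μ`-small subsets of `A`. -/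
theorem IsCompactFor.trans (h : IsCompactFor κ X) (hμκ : μ ≤ κ)
    (hμ : ∀ A : Set X, #A < κ → IsCompactFor μ A) : IsCompactFor μ X := by
  obtain ⟨U, _, hfine⟩ := h
  choose V hVc hVfine using fun A : SmallSubsets κ X => hμ A.1 A.2
  let image (A : SmallSubsets κ X) (B : SmallSubsets μ A.1) : SmallSubsets μ X :=
    ⟨Subtype.val '' B.1, Cardinal.mk_image_le.trans_lt B.2⟩
  refine ⟨U.bind fun A => (V A).map (image A), ⟨fun S hS hmem => ?_⟩, fun x => ?_⟩
  · have hball : ∀ᶠ A in U.toFilter, ∀ s ∈ S, ∀ᶠ B in (V A).toFilter, image A B ∈ s :=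
      (eventually_cardinal_ball (hS.trans_le hμκ)
        (p := fun A s _ => ∀ᶠ B in (V A).toFilter, image A B ∈ s)).2 hmem
    change ∀ᶠ A in U.toFilter, ∀ᶠ B in (V A).toFilter, image A B ∈ ⋂₀ S
    exact hball.mono fun A hA =>
      (eventually_cardinal_ball hS (p := fun B s _ => image A B ∈ s)).2 hA
  · change ∀ᶠ A in U.toFilter, ∀ᶠ B in (V A).toFilter, x ∈ (image A B).1
    exact mem_of_superset (hfine x) fun A hxA => mem_of_superset (hVfine A ⟨x, hxA⟩)
      fun B hxB => ⟨⟨x, hxA⟩, hxB, rfl⟩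

theorem IsSupercompact.isStronglyCompact (h : IsSupercompact κ) : IsStronglyCompact κ :=
  ⟨h.1, fun X => (h.2 X).imp fun _ hU => ⟨hU.1, hU.2.1⟩⟩

theorem IsSupercompact.exists_lt_nonempty_relHom (hκ : IsSupercompact κ)
    {V : κ.ord.ToType → Type u} (hV : ∀ i, #(V i) < κ) (E : ∀ i, V i → V i → Prop)
    (h : ∀ i j, i < j → Nonempty (E j →r E i)) : ∃ i j, i < j ∧ Nonempty (E i →r E j) := by
  have := Cardinal.noMaxOrder hκ.1.le
  by_cases hne : ∀ i, Nonempty (V i)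
  swap
  · obtain ⟨i, hi⟩ := not_forall.1 hne
    rw [not_nonempty_iff] at hi
    obtain ⟨j, hij⟩ := exists_gt i
    exact ⟨i, j, hij, ⟨isEmptyElim, fun {x} => isEmptyElim x⟩⟩
  have hex (i j) : ∃ φ : V j → V i, i < j → ∀ x y, E j x y → E i (φ x) (φ y) := by
    by_cases hij : i < j
    · exact (h i j hij).elim fun φ => ⟨φ, fun _ _ _ => φ.map_rel⟩
    · exact ⟨fun _ => Classical.arbitrary _, fun hlt => (hij hlt).elim⟩
  choose φ hφ using hex
  obtain ⟨U, _, hfine, hnormal⟩ := hκ.2 (κ.ord.ToType ⊕ ∀ i, V i)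
  obtain ⟨A, ⟨δ, hδ⟩, hreflect, hthread⟩ :=
    ((hnormal.eventually_exists_mem_iff_lt hfine (by simp)
        (fun i => by simpa using Cardinal.mk_Iio_lt i) Sum.inl_injective).and
      ((hnormal.eventually_exists_mem_of_exists hfine Sum.inl Sum.inr_injective
          fun c d i => ¬E i (c i) (d i)).and
        (hnormal.eventually_forall_exists_mem_eqOn hfine hV Sum.inl_injective Sum.inr))).exists
  choose ψ hψ hψφ using fun g : V δ => hthread fun i => φ i δ g
  obtain ⟨ε, hε⟩ := exists_gt δ
  refine ⟨δ, ε, hε, ⟨fun g => ψ g ε, fun {x y} hxy => ?_⟩⟩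
  by_contra hnot
  obtain ⟨i, hi, hni⟩ := hreflect (ψ x) (hψ x) (ψ y) (hψ y) ⟨ε, hnot⟩
  rw [hψφ x i hi, hψφ y i hi] at hni
  exact hni (hφ i δ ((hδ i).1 hi) x y hxy)

end Ultrafilters

section CumulativeHierarchy

variable {o : Ordinal.{u}} {a b f x y : ZFSet.{u}}

/-- A function between the elements of two sets, as a set of Kuratowski pairs. -/
noncomputable def functionGraph (φ : a → b) : ZFSet.{u} :=
  ZFSet.range fun x : a => ZFSet.pair x (φ x)

theorem pair_mem_functionGraph {φ : a → b} :
    ZFSet.pair x y ∈ functionGraph φ ↔ ∃ hx : x ∈ a, (φ ⟨x, hx⟩).1 = y := by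
  simp [functionGraph, ZFSet.pair_inj]

theorem functionGraph_subset_prod (φ : a → b) : functionGraph φ ⊆ ZFSet.prod a b := fun p hp => by
  obtain ⟨x, rfl⟩ := ZFSet.mem_range.1 hp
  exact ZFSet.pair_mem_prod.2 ⟨x.2, (φ x).2⟩

theorem isFunc_iff_exists_eq_functionGraph :
    ZFSet.IsFunc a b f ↔ ∃ φ : a → b, f = functionGraph φ := by
  constructor
  · rintro ⟨hsub, hf⟩
    choose φ hφ huniq using hf
    refine ⟨fun x => ⟨φ x x.2, (ZFSet.pair_mem_prod.1 (hsub (hφ x x.2))).2⟩, ?_⟩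
    ext p
    constructor
    · intro hp
      obtain ⟨x, hx, y, -, rfl⟩ := ZFSet.mem_prod.1 (hsub hp)
      exact pair_mem_functionGraph.2 ⟨hx, (huniq x hx y hp).symm⟩
    · intro hp
      obtain ⟨x, rfl⟩ := ZFSet.mem_range.1 hp
      exact hφ x x.2
  · rintro ⟨φ, rfl⟩
    exact ⟨functionGraph_subset_prod φ, fun x hx => ⟨φ ⟨x, hx⟩, pair_mem_functionGraph.2 ⟨hx, rfl⟩,
      fun y hy => (pair_mem_functionGraph.1 hy).2.symm⟩⟩

theorem nonempty_equiv_iff_card_eq : Nonempty (a ≃ b) ↔ a.card = b.card := by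
  rw [← Cardinal.eq, ZFSet.cardinalMk_coe_sort, ZFSet.cardinalMk_coe_sort, Cardinal.lift_inj]

theorem card_le_card_of_injective {φ : a → b} (hφ : φ.Injective) : a.card ≤ b.card := by
  rw [← Cardinal.lift_le.{u + 1}, ← ZFSet.cardinalMk_coe_sort, ← ZFSet.cardinalMk_coe_sort]
  exact Cardinal.mk_le_of_injective hφ

theorem mem_vonNeumann_of_mem (hxa : x ∈ a) (ha : a ∈ V_ o) : x ∈ V_ o :=
  ZFSet.isTransitive_vonNeumann o a ha hxa

theorem left_mem_vonNeumann_of_pair_mem (h : ZFSet.pair a b ∈ V_ o) : a ∈ V_ o :=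
  mem_vonNeumann_of_mem (x := a) (a := {a}) (by simp)
    (mem_vonNeumann_of_mem (by simp [ZFSet.pair]) h)

theorem right_mem_vonNeumann_of_pair_mem (h : ZFSet.pair a b ∈ V_ o) : b ∈ V_ o :=
  mem_vonNeumann_of_mem (x := b) (a := {a, b}) (by simp)
    (mem_vonNeumann_of_mem (by simp [ZFSet.pair]) h)

theorem unorderedPair_mem_vonNeumann (ho : Order.IsSuccLimit o) (ha : a ∈ V_ o) (hb : b ∈ V_ o) :
    ({a, b} : ZFSet) ∈ V_ o := by
  rw [ZFSet.mem_vonNeumann] at *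
  rw [ZFSet.rank_pair]
  exact max_lt (ho.succ_lt ha) (ho.succ_lt hb)

theorem powerset_mem_vonNeumann (ho : Order.IsSuccLimit o) (ha : a ∈ V_ o) :
    ZFSet.powerset a ∈ V_ o := by
  rw [ZFSet.mem_vonNeumann] at *
  rw [ZFSet.rank_powerset]
  exact ho.succ_lt ha

theorem sUnion_mem_vonNeumann (ha : a ∈ V_ o) : (⋃₀ a : ZFSet) ∈ V_ o :=
  ZFSet.mem_vonNeumann.2 ((ZFSet.rank_sUnion_le a).trans_lt (ZFSet.mem_vonNeumann.1 ha))

theorem prod_mem_vonNeumann (ho : Order.IsSuccLimit o) (ha : a ∈ V_ o) (hb : b ∈ V_ o) :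
    ZFSet.prod a b ∈ V_ o := by
  have hsub : ZFSet.prod a b ⊆ ZFSet.powerset (ZFSet.powerset (a ∪ b)) :=
    show ZFSet.pairSep _ a b ⊆ _ from ZFSet.sep_subset
  exact ZFSet.mem_vonNeumann_of_subset hsub (powerset_mem_vonNeumann ho
    (powerset_mem_vonNeumann ho (sUnion_mem_vonNeumann (unorderedPair_mem_vonNeumann ho ha hb))))

theorem functionGraph_mem_vonNeumann (ho : Order.IsSuccLimit o) (ha : a ∈ V_ o) (hb : b ∈ V_ o)
    (φ : a → b) : functionGraph φ ∈ V_ o :=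
  ZFSet.mem_vonNeumann_of_subset (functionGraph_subset_prod φ) (prod_mem_vonNeumann ho ha hb)

theorem toZFSet_mem_vonNeumann_iff {α : Ordinal.{u}} : α.toZFSet ∈ V_ o ↔ α < o := by
  rw [ZFSet.mem_vonNeumann, Ordinal.rank_toZFSet]

theorem mem_vonNeumann_of_card_lt_cof (ha : a ⊆ V_ o) (hcard : a.card < o.cof) : a ∈ V_ o := by
  let r (z : Shrink a) : Ordinal := ZFSet.rank ((equivShrink a).symm z).1
  have hr (z) : r z < o := ZFSet.mem_vonNeumann.1 (ha ((equivShrink a).symm z).2)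
  rw [ZFSet.mem_vonNeumann]
  calc ZFSet.rank a ≤ ⨆ z, r z + 1 := ZFSet.rank_le_iff.2 fun z hz => by
        simpa [r] using Ordinal.lt_iSup_add_one r (equivShrink a ⟨z, hz⟩)
    _ < o := Ordinal.iSup_add_one_lt_of_lt_cof hcard hr

theorem card_lt_of_mem_vonNeumann_ord {κ : Cardinal.{u}} (hκ : κ.IsInaccessible)
    (ha : a ∈ V_ κ.ord) : a.card < κ :=
  calc a.card ≤ (V_ (ZFSet.rank a)).card := ZFSet.card_mono (ZFSet.subset_vonNeumann_self a)
    _ = Cardinal.preBeth (ZFSet.rank a) := ZFSet.card_vonNeumann _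
    _ < Cardinal.preBeth κ.ord := Cardinal.preBeth_strictMono (ZFSet.mem_vonNeumann.1 ha)
    _ = κ := hκ.preBeth_ord

end CumulativeHierarchy

namespace VStructure

variable {o : Ordinal.{u}} {s z : ZFSet.{u}}

section Translation

variable {x y a b f p : VStructure o}

theorem mem_iff_val_mem_val : x ∈ y ↔ x.val ∈ y.val := Iff.rfl

theorem exists_val_eq (h : z ∈ y.val) : ∃ x : VStructure o, x.val = z :=
  ⟨⟨z, mem_vonNeumann_of_mem h y.property⟩, rfl⟩

theorem forall_mem_iff {q : ZFSet → Prop} :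
    (∀ x : VStructure o, x ∈ y → q x.val) ↔ ∀ z ∈ y.val, q z :=
  ⟨fun h z hz => by obtain ⟨x, rfl⟩ := exists_val_eq hz; exact h x hz, fun h x hx => h x.val hx⟩

theorem exists_mem_iff {q : ZFSet → Prop} :
    (∃ x : VStructure o, x ∈ y ∧ q x.val) ↔ ∃ z ∈ y.val, q z := by
  simpa using (forall_mem_iff (q := fun z => ¬q z)).not

theorem existsUnique_val_iff {q : ZFSet → Prop} (hq : ∀ z, q z → z ∈ V_ o) :
    (∃! x : VStructure o, q x.val) ↔ ∃! z, q z := by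
  constructor
  · rintro ⟨x, hx, huniq⟩
    exact ⟨x.val, hx, fun z hz => congrArg val (huniq ⟨z, hq z hz⟩ hz)⟩
  · rintro ⟨z, hz, huniq⟩
    exact ⟨⟨z, hq z hz⟩, hz, fun x hx => VStructure.ext (huniq x.val hx)⟩

theorem val_eq_iff_forall_mem_iff (hs : s ⊆ V_ o) :
    x.val = s ↔ ∀ z : VStructure o, z ∈ x ↔ z.val ∈ s := by
  refine ⟨fun h z => h ▸ Iff.rfl, fun h => ZFSet.ext fun z => ⟨fun hz => ?_, fun hz => ?_⟩⟩
  · obtain ⟨z, rfl⟩ := exists_val_eq hz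
    exact (h z).1 hz
  · exact (h ⟨z, hs hz⟩).2 hz

theorem val_subset_vonNeumann (x : VStructure o) : x.val ⊆ V_ o :=
  ZFSet.isTransitive_vonNeumann o x.val x.property

theorem sub_iff : SetModel.Sub x y ↔ x.val ⊆ y.val :=
  forall_mem_iff (q := fun z => z ∈ y.val)

theorem isUPair_iff : SetModel.IsUPair p a b ↔ p.val = {a.val, b.val} := by
  have hab : ({a.val, b.val} : ZFSet) ⊆ V_ o := fun z hz => by
    rcases ZFSet.mem_pair.1 hz with rfl | rfl
    exacts [a.property, b.property]
  simp only [val_eq_iff_forall_mem_iff hab, SetModel.IsUPair, ZFSet.mem_pair, VStructure.ext_iff]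

theorem isOPair_iff : SetModel.IsOPair p a b ↔ p.val = ZFSet.pair a.val b.val := by
  simp only [SetModel.IsOPair, isUPair_iff, ZFSet.pair_eq_singleton]
  constructor
  · rintro ⟨s, t, hs, ht, hp⟩
    rw [hp, hs, ht, ZFSet.pair]
  · intro hp
    obtain ⟨s, hs⟩ := exists_val_eq (y := p) (z := {a.val}) (by simp [hp, ZFSet.pair])
    obtain ⟨t, ht⟩ := exists_val_eq (y := p) (z := {a.val, b.val}) (by simp [hp, ZFSet.pair])
    exact ⟨s, t, hs, ht, by rw [hp, hs, ht, ZFSet.pair]⟩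

theorem pairMem_iff : SetModel.PairMem a b f ↔ ZFSet.pair a.val b.val ∈ f.val := by
  simp only [SetModel.PairMem, isOPair_iff]
  rw [exists_mem_iff (q := fun p => p = ZFSet.pair a.val b.val), exists_eq_right]

theorem isRel_iff : SetModel.IsRel f a b ↔ f.val ⊆ ZFSet.prod a.val b.val := by
  have hpair (p : VStructure o) :
      (∃ x y : VStructure o, x ∈ a ∧ y ∈ b ∧ SetModel.IsOPair p x y) ↔
        p.val ∈ ZFSet.prod a.val b.val := by
    simp only [isOPair_iff, ZFSet.mem_prod, ← exists_mem_iff, exists_and_left]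
  simp only [SetModel.IsRel, hpair]
  exact forall_mem_iff (q := fun p => p ∈ ZFSet.prod a.val b.val)

theorem isFun_iff : SetModel.IsFun f a b ↔ ∃ φ : a.val → b.val, f.val = functionGraph φ := by
  rw [← isFunc_iff_exists_eq_functionGraph, SetModel.IsFun, isRel_iff, ZFSet.IsFunc,
    ← forall_mem_iff]
  refine and_congr_right fun hf => forall₂_congr fun x _ => ?_
  simp only [pairMem_iff]
  exact existsUnique_val_iff fun y hy =>
    b.val_subset_vonNeumann (ZFSet.pair_mem_prod.1 (hf hy)).2

theorem isBij_iff : SetModel.IsBij f a b ↔ ∃ φ : a.val ≃ b.val, f.val = functionGraph φ := by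
  have hbij (φ : a.val → b.val) (hφ : f.val = functionGraph φ) :
      (∀ y : VStructure o, y ∈ b → ∃! x : VStructure o, ZFSet.pair x.val y.val ∈ f.val) ↔
        φ.Bijective := by
    rw [forall_mem_iff (q := fun y => ∃! x : VStructure o, ZFSet.pair x.val y ∈ f.val),
      Function.bijective_iff_existsUnique, Subtype.forall]
    refine forall₂_congr fun y hy => ?_
    rw [existsUnique_val_iff (q := fun x => ZFSet.pair x y ∈ f.val) fun x hx =>
      left_mem_vonNeumann_of_pair_mem (f.val_subset_vonNeumann hx)]
    simp only [hφ, pair_mem_functionGraph, ExistsUnique, Subtype.exists, Subtype.forall,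
      Subtype.mk.injEq]
    grind
  simp only [SetModel.IsBij, isFun_iff, pairMem_iff]
  constructor
  · rintro ⟨⟨φ, hφ⟩, h⟩
    exact ⟨.ofBijective φ ((hbij φ hφ).1 h), hφ⟩
  · rintro ⟨φ, hφ⟩
    exact ⟨⟨φ, hφ⟩, (hbij φ hφ).2 φ.bijective⟩

end Translation

/-- The set `z ∈ V_o` as an element of `⟨V_{o+1}, ∈⟩`. -/
def ofMem (z : ZFSet.{u}) (hz : z ∈ V_ o) : VStructure (o + 1) :=
  ⟨z, ZFSet.vonNeumann_subset_of_le (le_add_of_nonneg_right zero_le_one) hz⟩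

/-- The class `s ⊆ V_o` as an element of `⟨V_{o+1}, ∈⟩`. -/
def ofSubset (s : ZFSet.{u}) (hs : s ⊆ V_ o) : VStructure (o + 1) :=
  ⟨s, by simpa using hs⟩

section Classes

variable {x y a k w F : VStructure (o + 1)} {α : Ordinal.{u}} {μ : Cardinal.{u}}

@[simp]
theorem val_ofMem (hz : z ∈ V_ o) : (ofMem z hz).val = z := rfl

@[simp]
theorem val_ofSubset (hs : s ⊆ V_ o) : (ofSubset s hs).val = s := rfl

theorem mem_vonNeumann_of_mem_val (hz : z ∈ x.val) : z ∈ V_ o := by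
  have hx := x.property
  rw [ZFSet.vonNeumann_add_one, ZFSet.mem_powerset] at hx
  exact hx hz

theorem isSet_iff : SetModel.IsSet x ↔ x.val ∈ V_ o :=
  ⟨fun ⟨_, hy⟩ => mem_vonNeumann_of_mem_val hy,
    fun hx => ⟨ofSubset (V_ o) fun _ h => h, hx⟩⟩

theorem isOrd_iff : SetModel.IsOrd a ↔ ∃ α < o, a.val = α.toZFSet := by
  have hord : SetModel.IsOrd a ↔ a.val ∈ V_ o ∧ a.val.IsOrdinal := by
    have htrans (x : VStructure (o + 1)) :
        (∀ y : VStructure (o + 1), y ∈ x → SetModel.Sub y x) ↔ x.val.IsTransitive := by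
      simp only [sub_iff]
      exact forall_mem_iff (q := fun z => z ⊆ x.val)
    simp only [SetModel.IsOrd, isSet_iff, ZFSet.isOrdinal_iff_forall_mem_isTransitive, htrans,
      forall_mem_iff (q := ZFSet.IsTransitive)]
  rw [hord]
  constructor
  · rintro ⟨ha, hord⟩
    exact ⟨a.val.rank, ZFSet.mem_vonNeumann.1 ha, hord.toZFSet_rank_eq.symm⟩
  · rintro ⟨α, hα, h⟩
    exact h ▸ ⟨toZFSet_mem_vonNeumann_iff.2 hα, ZFSet.isOrdinal_toZFSet α⟩

theorem equinumerous_iff (ho : Order.IsSuccLimit o) (hx : x.val ∈ V_ o) (hy : y.val ∈ V_ o) :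
    SetModel.Equinumerous x y ↔ x.val.card = y.val.card := by
  simp only [SetModel.Equinumerous, isBij_iff, ← nonempty_equiv_iff_card_eq]
  constructor
  · rintro ⟨-, -, φ, -⟩
    exact ⟨φ⟩
  · rintro ⟨φ⟩
    have hφ := functionGraph_mem_vonNeumann ho hx hy φ
    exact ⟨ofMem _ hφ, isSet_iff.2 hφ, φ, rfl⟩

theorem forall_mem_iff_of_val_eq_toZFSet (ha : a.val = α.toZFSet) {q : ZFSet → Prop} :
    (∀ x : VStructure (o + 1), x ∈ a → q x.val) ↔ ∀ β < α, q β.toZFSet := by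
  simp [forall_mem_iff, ha, Ordinal.mem_toZFSet_iff]

theorem exists_mem_iff_of_val_eq_toZFSet (ha : a.val = α.toZFSet) {q : ZFSet → Prop} :
    (∃ x : VStructure (o + 1), x ∈ a ∧ q x.val) ↔ ∃ β < α, q β.toZFSet := by
  simp [exists_mem_iff, ha, Ordinal.mem_toZFSet_iff]

theorem isLimitOrd_iff :
    SetModel.IsLimitOrd a ↔ ∃ α < o, Order.IsSuccLimit α ∧ a.val = α.toZFSet := by
  have hlimit {α : Ordinal} (ha : a.val = α.toZFSet) :
      ((∃ x, x ∈ a) ∧ ∀ x, x ∈ a → ∃ y, y ∈ a ∧ x ∈ y) ↔ Order.IsSuccLimit α := by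
    have hne : (∃ x, x ∈ a) ↔ α ≠ 0 := by
      rw [← pos_iff_ne_zero]
      simpa using (exists_mem_iff_of_val_eq_toZFSet ha (q := fun _ => True)).trans
        ⟨fun ⟨_, hβ, _⟩ => pos_of_gt hβ, fun h => ⟨0, h, trivial⟩⟩
    have hlt (x : VStructure (o + 1)) : (∃ y, y ∈ a ∧ x ∈ y) ↔ ∃ γ < α, x.val ∈ γ.toZFSet :=
      exists_mem_iff_of_val_eq_toZFSet ha (q := fun z => x.val ∈ z)
    simp only [hlt, forall_mem_iff_of_val_eq_toZFSet ha (q := fun z => ∃ γ < α, z ∈ γ.toZFSet),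
      Ordinal.toZFSet_mem_toZFSet_iff, hne]
    rw [Ordinal.isSuccLimit_iff, Order.isSuccPrelimit_iff_succ_lt]
    exact and_congr_right fun _ => forall₂_congr fun β _ =>
      ⟨fun ⟨γ, hγ, hβγ⟩ => (Order.succ_le_of_lt hβγ).trans_lt hγ,
        fun h => ⟨_, h, Order.lt_succ β⟩⟩
  rw [SetModel.IsLimitOrd, isOrd_iff]
  constructor
  · rintro ⟨⟨α, hα, ha⟩, h⟩
    exact ⟨α, hα, (hlimit ha).1 h, ha⟩
  · rintro ⟨α, hα, hlim, ha⟩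
    exact ⟨⟨α, hα, ha⟩, (hlimit ha).2 hlim⟩

theorem isOmega_iff :
    SetModel.IsOmega w ↔ Ordinal.omega0 < o ∧ w.val = Ordinal.omega0.toZFSet := by
  rw [SetModel.IsOmega, isLimitOrd_iff]
  simp only [isLimitOrd_iff]
  constructor
  · rintro ⟨⟨α, hα, hlim, hw⟩, hleast⟩
    rw [forall_mem_iff_of_val_eq_toZFSet hw
      (q := fun z => ¬∃ β < o, Order.IsSuccLimit β ∧ z = β.toZFSet)] at hleast
    obtain rfl : Ordinal.omega0 = α :=
      (Ordinal.omega0_le_of_isSuccLimit hlim).eq_of_not_lt fun hlt =>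
        hleast _ hlt ⟨_, hlt.trans hα, Ordinal.isSuccLimit_omega0, rfl⟩
    exact ⟨hα, hw⟩
  · rintro ⟨hω, hw⟩
    refine ⟨⟨_, hω, Ordinal.isSuccLimit_omega0, hw⟩, ?_⟩
    rw [forall_mem_iff_of_val_eq_toZFSet hw
      (q := fun z => ¬∃ β < o, Order.IsSuccLimit β ∧ z = β.toZFSet)]
    rintro β hβ ⟨γ, -, hγ, heq⟩
    rw [Ordinal.toZFSet_injective heq] at hβ
    exact hβ.not_ge (Ordinal.omega0_le_of_isSuccLimit hγ)

theorem isCard_iff (ho : Order.IsSuccLimit o) :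
    SetModel.IsCard k ↔ ∃ μ : Cardinal, μ.ord < o ∧ k.val = μ.ord.toZFSet := by
  have hinitial {α : Ordinal} (hα : α < o) (hk : k.val = α.toZFSet) :
      (∀ a : VStructure (o + 1), a ∈ k → ¬SetModel.Equinumerous a k) ↔
        ∀ β < α, β.card ≠ α.card := by
    have hkV : k.val ∈ V_ o := hk ▸ toZFSet_mem_vonNeumann_iff.2 hα
    have hequi : (∀ a : VStructure (o + 1), a ∈ k → ¬SetModel.Equinumerous a k) ↔
        ∀ a : VStructure (o + 1), a ∈ k → a.val.card ≠ α.card :=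
      forall₂_congr fun a ha => by
        rw [equinumerous_iff ho (mem_vonNeumann_of_mem_val ha) hkV, hk, Ordinal.card_toZFSet]
    rw [hequi, forall_mem_iff_of_val_eq_toZFSet hk (q := fun a => a.card ≠ α.card)]
    simp only [Ordinal.card_toZFSet]
  rw [SetModel.IsCard, isOrd_iff]
  constructor
  · rintro ⟨⟨α, hα, hk⟩, h⟩
    have hcard : α.card.ord = α := (Cardinal.ord_card_le α).eq_of_not_lt fun hlt =>
      (hinitial hα hk).1 h _ hlt (Cardinal.card_ord _)
    exact ⟨α.card, hcard.symm ▸ hα, hcard.symm ▸ hk⟩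
  · rintro ⟨μ, hμ, hk⟩
    refine ⟨⟨μ.ord, hμ, hk⟩, (hinitial hμ hk).2 fun β hβ => ?_⟩
    rw [Cardinal.card_ord]
    exact (Cardinal.lt_ord.1 hβ).ne

theorem isUncountableCard_iff (ho : Order.IsSuccLimit o) :
    SetModel.IsUncountableCard k ↔
      ∃ μ : Cardinal, ℵ₀ < μ ∧ μ.ord < o ∧ k.val = μ.ord.toZFSet := by
  have hω {μ : Cardinal} (hμ : μ.ord < o) (hk : k.val = μ.ord.toZFSet) :
      (∃ w : VStructure (o + 1), SetModel.IsOmega w ∧ w ∈ k) ↔ ℵ₀ < μ := by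
    simp only [isOmega_iff, and_comm (b := _ ∈ k)]
    rw [exists_mem_iff_of_val_eq_toZFSet hk
      (q := fun w => Ordinal.omega0 < o ∧ w = Ordinal.omega0.toZFSet),
      ← Ordinal.card_omega0, ← Cardinal.lt_ord]
    simp only [Ordinal.toZFSet_injective.eq_iff]
    exact ⟨fun ⟨_, hβ, _, hβω⟩ => hβω ▸ hβ, fun h => ⟨_, h, h.trans hμ, rfl⟩⟩
  rw [SetModel.IsUncountableCard, isCard_iff ho]
  constructor
  · rintro ⟨⟨μ, hμ, hk⟩, h⟩
    exact ⟨μ, (hω hμ hk).1 h, hμ, hk⟩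
  · rintro ⟨μ, hμω, hμ, hk⟩
    exact ⟨⟨μ, hμ, hk⟩, (hω hμ hk).2 hμω⟩

theorem cardLT_iff (ho : Order.IsSuccLimit o) (hx : x.val ∈ V_ o) (hk : k.val = μ.ord.toZFSet) :
    SetModel.CardLT x k ↔ x.val.card < μ := by
  have hequi : SetModel.CardLT x k ↔ ∃ a, a ∈ k ∧ x.val.card = a.val.card :=
    exists_congr fun a => and_congr_right fun ha =>
      equinumerous_iff ho hx (mem_vonNeumann_of_mem_val ha)
  rw [hequi, exists_mem_iff_of_val_eq_toZFSet hk (q := fun a => x.val.card = a.card)]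
  constructor
  · rintro ⟨β, hβ, h⟩
    rwa [h, Ordinal.card_toZFSet, ← Cardinal.lt_ord]
  · exact fun h => ⟨x.val.card.ord, Cardinal.ord_strictMono h, by simp⟩

end Classes

end VStructure

namespace SetModel.IsCompleteUltrafilter

open VStructure

variable {o : Ordinal.{u}} {μ : Cardinal.{u}} {U P k : VStructure (o + 1)} {p q : ZFSet.{u} → Prop}

theorem val_mem_vonNeumann (hU : IsCompleteUltrafilter U P k) : P.val ∈ V_ o :=
  mem_vonNeumann_of_mem_val hU.whole

theorem sep_mem_vonNeumann (hU : IsCompleteUltrafilter U P k) (p : ZFSet → Prop) :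
    P.val.sep p ∈ V_ o :=
  ZFSet.mem_vonNeumann_of_subset ZFSet.sep_subset hU.val_mem_vonNeumann

theorem sep_mem_of_mem {T : VStructure (o + 1)} (hTU : T ∈ U)
    (hT : ∀ a : VStructure (o + 1), a ∈ T ↔ a ∈ P ∧ p a.val) : P.val.sep p ∈ U.val := by
  have hsep : P.val.sep p ⊆ V_ (o + 1) := fun z hz =>
    P.val_subset_vonNeumann (ZFSet.sep_subset hz)
  rwa [← (val_eq_iff_forall_mem_iff hsep).2 fun a => (hT a).trans ZFSet.mem_sep.symm]

theorem exists_of_sep_mem (hU : IsCompleteUltrafilter U P k) (h : P.val.sep p ∈ U.val) :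
    ∃ z ∈ P.val, p z := by
  obtain ⟨a, ha⟩ := hU.proper (ofMem _ (hU.sep_mem_vonNeumann p)) h
  exact ⟨a.val, ZFSet.mem_sep.1 ha⟩

theorem sep_mem_of_imp (hU : IsCompleteUltrafilter U P k) (h : P.val.sep p ∈ U.val)
    (hpq : ∀ z, p z → q z) : P.val.sep q ∈ U.val :=
  hU.upward (ofMem _ (hU.sep_mem_vonNeumann p)) (ofMem _ (hU.sep_mem_vonNeumann q)) h
    (sub_iff.2 fun _ hz => ZFSet.mem_sep.2 ((ZFSet.mem_sep.1 hz).imp_right (hpq _)))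
    (sub_iff.2 ZFSet.sep_subset)

theorem sep_mem_or_sep_not_mem (hU : IsCompleteUltrafilter U P k) (p : ZFSet → Prop) :
    P.val.sep p ∈ U.val ∨ (P.val.sep fun z => ¬p z) ∈ U.val := by
  have hp := hU.sep_mem_vonNeumann p
  refine (hU.ultra (ofMem _ hp) (isSet_iff.2 hp) (sub_iff.2 ZFSet.sep_subset)).imp_right ?_
  rintro ⟨T, hTU, hT⟩
  refine sep_mem_of_mem hTU fun a => (hT a).trans (and_congr_right fun ha => not_congr ?_)
  exact ZFSet.mem_sep.trans (and_iff_right ha)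

theorem sep_forall_mem (hU : IsCompleteUltrafilter U P k) (ho : Order.IsSuccLimit o)
    (hk : k.val = μ.ord.toZFSet) {ι : Type u} (hι : #ι < μ) {p : ι → ZFSet → Prop}
    (h : ∀ i, P.val.sep (p i) ∈ U.val) : (P.val.sep fun z => ∀ i, p i z) ∈ U.val := by
  let B := ZFSet.range fun i => P.val.sep (p i)
  have hBU : B ⊆ U.val := fun z hz => by
    obtain ⟨i, rfl⟩ := ZFSet.mem_range.1 hz
    exact h i
  have hB : B ∈ V_ o := ZFSet.mem_vonNeumann_of_subset hBU (isSet_iff.1 hU.isSet)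
  have hcard : B.card < μ :=
    lt_of_le_of_lt (by simpa using ZFSet.lift_card_range_le (f := fun i => P.val.sep (p i))) hι
  obtain ⟨T, hTU, hT⟩ := hU.complete (ofMem B hB) (isSet_iff.2 hB) (sub_iff.2 hBU)
    ((cardLT_iff ho hB hk).2 hcard)
  refine sep_mem_of_mem hTU fun a => (hT a).trans (and_congr_right fun ha => ?_)
  simp only [mem_iff_val_mem_val (x := a)]
  rw [forall_mem_iff (q := fun z => a.val ∈ z)]
  simp only [val_ofMem, B, ZFSet.mem_range, forall_exists_index, forall_apply_eq_imp_iff,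
    ZFSet.mem_sep]
  exact forall_congr' fun i => and_iff_right ha

theorem exists_ultrafilter_forall_mem_iff (hU : IsCompleteUltrafilter U P k)
    (ho : Order.IsSuccLimit o) (hk : k.val = μ.ord.toZFSet) (hμ : 2 < μ) {β : Type u}
    (d : ZFSet.{u} → β) :
    ∃ W : Ultrafilter β, CardinalInterFilter W.toFilter μ ∧
      ∀ s, s ∈ W ↔ (P.val.sep fun z => d z ∈ s) ∈ U.val := by
  let F := Filter.ofCardinalInter {s | (P.val.sep fun z => d z ∈ s) ∈ U.val} hμ
    (fun S hS hSU => hU.sep_mem_of_imp (hU.sep_forall_mem ho hk hS fun s : S => hSU s.2)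
      fun z hz s hs => hz ⟨s, hs⟩)
    (fun s t hs hst => hU.sep_mem_of_imp hs fun z hz => hst hz)
  have hF (s : Set β) : sᶜ ∉ F ↔ s ∈ F := by
    refine ⟨(hU.sep_mem_or_sep_not_mem fun z => d z ∈ s).resolve_right, fun hs hsc => ?_⟩
    obtain ⟨z, -, hz, hzc⟩ := hU.exists_of_sep_mem (Filter.inter_mem hs hsc)
    exact hzc hz
  exact ⟨.ofComplNotMemIff F hF, inferInstanceAs (CardinalInterFilter F μ), fun s => Iff.rfl⟩

end SetModel.IsCompleteUltrafilter

namespace VStructure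

section StronglyCompact

variable {o : Ordinal.{u}} {κ μ : Cardinal.{u}} {k X P U : VStructure (o + 1)} {A : Type u}

theorem isCompactFor_of_isFine (ho : Order.IsSuccLimit o) (hk : k.val = μ.ord.toZFSet)
    (hμ : 2 < μ) (hP : SetModel.IsSmallSubsets P k X)
    (hU : SetModel.IsCompleteUltrafilter U P k) (hfine : SetModel.IsFine U P X)
    (e : A ≃ X.val) : IsCompactFor μ A := by
  have hdecode (z : ZFSet) : ∃ B : SmallSubsets μ A, z ∈ P.val → B.1 = {x | (e x).1 ∈ z} := by
    by_cases hz : z ∈ P.val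
    · obtain ⟨a, rfl⟩ := exists_val_eq hz
      obtain ⟨ha, -, hlt⟩ := (hP.2 a).1 hz
      rw [cardLT_iff ho (isSet_iff.1 ha) hk] at hlt
      have hle : #{x | (e x).1 ∈ a.val} ≤ a.val.card := by
        rw [← Cardinal.lift_le.{u + 1}, ← ZFSet.cardinalMk_coe_sort]
        exact (Cardinal.mk_preimage_of_injective_lift (fun x => (e x).1) (a.val : Set ZFSet)
          (Subtype.val_injective.comp e.injective)).trans (Cardinal.lift_id'.{u, u + 1} _).le
      exact ⟨⟨_, hle.trans_lt hlt⟩, fun _ => rfl⟩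
    · exact ⟨⟨∅, by simpa using pos_of_gt hμ⟩, fun h => (hz h).elim⟩
  choose d hd using hdecode
  obtain ⟨W, hW, hmem⟩ := hU.exists_ultrafilter_forall_mem_iff ho hk hμ d
  refine ⟨W, hW, fun x => (hmem _).2 ?_⟩
  obtain ⟨T, hTU, hT⟩ := hfine (ofMem (e x).1 (mem_vonNeumann_of_mem_val (e x).2)) (e x).2
  refine SetModel.IsCompleteUltrafilter.sep_mem_of_mem hTU fun a => (hT a).trans
    (and_congr_right fun ha => ?_)
  rw [Set.mem_ofPred_eq, hd a.val ha]
  rfl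

theorem exists_isCompactFor_of_isStronglyCompactIn (ho : Order.IsSuccLimit o)
    (h : SetModel.IsStronglyCompactIn k) :
    ∃ μ : Cardinal, ℵ₀ < μ ∧ μ.ord < o ∧ ∀ A : Type u, (#A).ord < o → IsCompactFor μ A := by
  obtain ⟨μ, hμ, hμo, hk⟩ := (isUncountableCard_iff ho).1 h.1
  refine ⟨μ, hμ, hμo, fun A hA => ?_⟩
  have hX := toZFSet_mem_vonNeumann_iff.2 hA
  obtain ⟨P, U, hP, hU, hfine⟩ := h.2 (ofMem _ hX) (isSet_iff.2 hX)
  obtain ⟨e⟩ : Nonempty (A ≃ (#A).ord.toZFSet) := by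
    rw [← Cardinal.lift_mk_eq', ZFSet.cardinalMk_coe_sort]
    simp
  exact isCompactFor_of_isFine ho hk (Cardinal.ofNat_lt_aleph0.trans hμ) hP hU hfine e

theorem not_satisfiesExistsStronglyCompact (hκ : IsLeast {μ | IsStronglyCompact μ} κ) :
    ¬SetModel.SatisfiesExistsStronglyCompact (VStructure (κ.ord + 1)) := by
  rintro ⟨k, hk⟩
  obtain ⟨μ, hμ, hμκ, hcompact⟩ :=
    exists_isCompactFor_of_isStronglyCompactIn (Cardinal.isSuccLimit_ord hκ.1.1.le) hk
  rw [Cardinal.ord_lt_ord] at hμκ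
  have hstrong : IsStronglyCompact μ := ⟨hμ, fun X => (hκ.1.2 X).trans hμκ.le fun A hA =>
    hcompact A (Cardinal.ord_lt_ord.2 hA)⟩
  exact (hκ.2 hstrong).not_gt hμκ

end StronglyCompact

section GraphSequences

variable {o : Ordinal.{u}} {κ : Cardinal.{u}}

/-- The edge relation of the graph `⟨v, e⟩`, on the type of elements of `v`. -/
def edgeRel (v e : ZFSet.{u}) (x y : v) : Prop := ZFSet.pair x y ∈ e

variable {F g g' v v' e e' α : VStructure (o + 1)}

theorem isGraphWith_iff : SetModel.IsGraphWith g v e ↔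
    g.val = ZFSet.pair v.val e.val ∧ e.val ⊆ ZFSet.prod v.val v.val := by
  rw [SetModel.IsGraphWith, isOPair_iff, isRel_iff]

theorem isGraphHom_iff (hg : SetModel.IsGraphWith g v e) (hg' : SetModel.IsGraphWith g' v' e')
    {h : VStructure (o + 1)} : SetModel.IsGraphHom h g g' ↔
      ∃ φ : edgeRel v.val e.val →r edgeRel v'.val e'.val, h.val = functionGraph φ := by
  have hunique {g v e w f : VStructure (o + 1)} (hve : SetModel.IsGraphWith g v e)
      (hwf : SetModel.IsGraphWith g w f) : w = v ∧ f = e := by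
    simpa only [VStructure.ext_iff] using
      ZFSet.pair_inj.1 ((isGraphWith_iff.1 hwf).1.symm.trans (isGraphWith_iff.1 hve).1)
  constructor
  · rintro ⟨w, f, w', f', hw, hw', hfun, hhom⟩
    obtain ⟨rfl, rfl⟩ := hunique hg hw
    obtain ⟨rfl, rfl⟩ := hunique hg' hw'
    obtain ⟨φ, hφ⟩ := isFun_iff.1 hfun
    have hV {z : ZFSet} {x : VStructure (o + 1)} (hz : z ∈ x.val) : z ∈ V_ o :=
      mem_vonNeumann_of_mem_val hz
    refine ⟨⟨φ, fun {x y} hxy => ?_⟩, hφ⟩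
    have := hhom (ofMem x (hV x.2)) (ofMem y (hV y.2)) (ofMem (φ x) (hV (φ x).2))
      (ofMem (φ y) (hV (φ y).2))
    simp only [pairMem_iff, val_ofMem, hφ, pair_mem_functionGraph] at this
    exact this hxy ⟨x.2, trivial⟩ ⟨y.2, trivial⟩
  · rintro ⟨φ, hφ⟩
    refine ⟨v, e, v', e', hg, hg', isFun_iff.2 ⟨φ, hφ⟩, ?_⟩
    simp only [pairMem_iff, hφ, pair_mem_functionGraph]
    rintro x y x' y' hxy ⟨hx, hx'⟩ ⟨hy, hy'⟩
    rw [← hx', ← hy']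
    exact φ.map_rel hxy

theorem homExists_iff (ho : Order.IsSuccLimit o) (hg : SetModel.IsGraphWith g v e)
    (hg' : SetModel.IsGraphWith g' v' e') (hv : v.val ∈ V_ o) (hv' : v'.val ∈ V_ o) :
    SetModel.HomExists g g' ↔ Nonempty (edgeRel v.val e.val →r edgeRel v'.val e'.val) := by
  simp only [SetModel.HomExists, isGraphHom_iff hg hg']
  constructor
  · rintro ⟨-, -, φ, -⟩
    exact ⟨φ⟩
  · rintro ⟨φ⟩
    have hφ := functionGraph_mem_vonNeumann ho hv hv' φ
    exact ⟨ofMem _ hφ, isSet_iff.2 hφ, φ, rfl⟩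

theorem exists_isGraphWith_of_isGraphSequence (hF : SetModel.IsGraphSequence F)
    (hα : SetModel.IsOrd α) :
    ∃ g v e, SetModel.PairMem α g F ∧ SetModel.IsGraphWith g v e ∧ v.val ∈ V_ o := by
  obtain ⟨g, ⟨p, hpF, hp⟩, -⟩ := hF.2 α hα
  obtain ⟨β, g', -, ⟨v, e, hve⟩, hp'⟩ := hF.1 p hpF
  have hpair := (isOPair_iff.1 hp).symm.trans (isOPair_iff.1 hp')
  obtain rfl : g = g' := VStructure.ext (ZFSet.pair_inj.1 hpair).2
  have hgV : g.val ∈ V_ o := right_mem_vonNeumann_of_pair_mem (a := α.val)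
    (isOPair_iff.1 hp ▸ mem_vonNeumann_of_mem_val hpF)
  exact ⟨g, v, e, ⟨p, hpF, hp⟩, hve,
    left_mem_vonNeumann_of_pair_mem ((isGraphWith_iff.1 hve).1 ▸ hgV)⟩

theorem satisfiesSWVP (hκ : IsSupercompact κ) :
    SetModel.SatisfiesSWVP (VStructure (κ.ord + 1)) := by
  rintro ⟨F, hF, hdown, hup⟩
  have hin := hκ.isStronglyCompact.isInaccessible
  have ho := Cardinal.isSuccLimit_ord hκ.1.le
  let α (i : κ.ord.ToType) : VStructure (κ.ord + 1) :=
    ofMem (Ordinal.ToType.toOrd i).1.toZFSet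
      (toZFSet_mem_vonNeumann_iff.2 (Ordinal.ToType.toOrd i).2)
  have hα (i) : SetModel.IsOrd (α i) := isOrd_iff.2 ⟨_, (Ordinal.ToType.toOrd i).2, rfl⟩
  have hαlt {i j} (hij : i < j) : α i ∈ α j :=
    Ordinal.toZFSet_mem_toZFSet_iff.2 (Ordinal.ToType.mk.symm.lt_iff_lt.2 hij)
  choose g v e hg hve hv using fun i => exists_isGraphWith_of_isGraphSequence hF (hα i)
  have hhom (i j) := homExists_iff ho (hve i) (hve j) (hv i) (hv j)
  let ρ (i) := RelIso.preimage (equivShrink (v i).val).symm (edgeRel (v i).val (e i).val)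
  obtain ⟨i, j, hij, ⟨φ⟩⟩ := hκ.exists_lt_nonempty_relHom
    (fun i => card_lt_of_mem_vonNeumann_ord hin (hv i))
    (fun i => (equivShrink (v i).val).symm ⁻¹'o edgeRel (v i).val (e i).val) fun i j hij => by
      obtain ⟨φ⟩ := (hhom j i).1
        (hdown _ _ _ _ (hα i) (hα j) (hg i) (hg j) (.inl (hαlt hij)))
      exact ⟨(ρ i).symm.toRelEmbedding.toRelHom.comp (φ.comp (ρ j).toRelEmbedding.toRelHom)⟩
  exact hup _ _ _ _ (hα i) (hα j) (hg i) (hg j) (hαlt hij) <| (hhom i j).2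
    ⟨(ρ j).toRelEmbedding.toRelHom.comp (φ.comp (ρ i).symm.toRelEmbedding.toRelHom)⟩

end GraphSequences

section Axioms

variable {o : Ordinal.{u}} {κ : Cardinal.{u}}

theorem extensionality {x y : VStructure o} (h : ∀ z, z ∈ x ↔ z ∈ y) : x = y :=
  VStructure.ext <| (val_eq_iff_forall_mem_iff y.val_subset_vonNeumann).2 h

theorem foundation {X : VStructure o} (hX : ∃ x : VStructure o, x ∈ X) :
    ∃ x : VStructure o, x ∈ X ∧ ∀ z : VStructure o, z ∈ x → z ∉ X := by
  obtain ⟨x, hx⟩ := hX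
  obtain ⟨z, hzX, hz⟩ := ZFSet.regularity X.val fun h => ZFSet.notMem_empty x.val (h ▸ hx)
  obtain ⟨y, rfl⟩ := exists_val_eq hzX
  exact ⟨y, hzX, fun w hwy hwX => ZFSet.notMem_empty w.val (hz ▸ ZFSet.mem_inter.2 ⟨hwX, hwy⟩)⟩

theorem exists_class (p : VStructure (o + 1) → Prop) :
    ∃ C : VStructure (o + 1), ∀ x, x ∈ C ↔ SetModel.IsSet x ∧ p x := by
  refine ⟨ofSubset ((V_ o).sep fun z => ∃ x, x.val = z ∧ p x) ZFSet.sep_subset, fun x => ?_⟩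
  rw [mem_iff_val_mem_val, val_ofSubset, ZFSet.mem_sep, isSet_iff]
  simp only [← VStructure.ext_iff, exists_eq_left]

theorem exists_unorderedPair (ho : Order.IsSuccLimit o) {a b : VStructure (o + 1)}
    (ha : SetModel.IsSet a) (hb : SetModel.IsSet b) :
    ∃ z, SetModel.IsSet z ∧ SetModel.IsUPair z a b := by
  have h := unorderedPair_mem_vonNeumann ho (isSet_iff.1 ha) (isSet_iff.1 hb)
  exact ⟨ofMem _ h, isSet_iff.2 h, isUPair_iff.2 rfl⟩

theorem exists_union {a : VStructure (o + 1)} (ha : SetModel.IsSet a) :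
    ∃ z : VStructure (o + 1), SetModel.IsSet z ∧ ∀ x, x ∈ z ↔ ∃ y, y ∈ a ∧ x ∈ y := by
  have h := sUnion_mem_vonNeumann (isSet_iff.1 ha)
  refine ⟨ofMem _ h, isSet_iff.2 h, fun x => ?_⟩
  rw [mem_iff_val_mem_val, val_ofMem, ZFSet.mem_sUnion]
  exact (exists_mem_iff (q := fun z => x.val ∈ z)).symm

theorem exists_powerset (ho : Order.IsSuccLimit o) {a : VStructure (o + 1)}
    (ha : SetModel.IsSet a) :
    ∃ z : VStructure (o + 1), SetModel.IsSet z ∧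
      ∀ x, x ∈ z ↔ SetModel.IsSet x ∧ SetModel.Sub x a := by
  rw [isSet_iff] at ha
  have h := powerset_mem_vonNeumann ho ha
  refine ⟨ofMem _ h, isSet_iff.2 h, fun x => ?_⟩
  rw [mem_iff_val_mem_val, val_ofMem, ZFSet.mem_powerset, sub_iff, isSet_iff]
  exact (and_iff_right_of_imp fun hx => ZFSet.mem_vonNeumann_of_subset hx ha).symm

theorem exists_inductive (ho : Ordinal.omega0 < o) :
    ∃ w : VStructure (o + 1), SetModel.IsSet w ∧
      (∃ e : VStructure (o + 1), e ∈ w ∧ ∀ z : VStructure (o + 1), z ∉ e) ∧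
      ∀ x, x ∈ w → ∃ y : VStructure (o + 1), y ∈ w ∧ ∀ z, z ∈ y ↔ z ∈ x ∨ z = x := by
  have hω := toZFSet_mem_vonNeumann_iff.2 ho
  refine ⟨ofMem _ hω, isSet_iff.2 hω, ?_, fun x hx => ?_⟩
  · have h0 : (0 : Ordinal).toZFSet ∈ Ordinal.omega0.toZFSet :=
      Ordinal.toZFSet_mem_toZFSet_iff.2 Ordinal.omega0_pos
    exact ⟨ofMem _ (mem_vonNeumann_of_mem h0 hω), h0, fun z hz =>
      ZFSet.notMem_empty z.val (Ordinal.toZFSet_zero ▸ hz)⟩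
  · obtain ⟨n, hn, hnx⟩ := Ordinal.mem_toZFSet_iff.1 hx
    have hsucc : (n + 1).toZFSet ∈ Ordinal.omega0.toZFSet :=
      Ordinal.toZFSet_mem_toZFSet_iff.2 (Ordinal.isSuccLimit_omega0.add_one_lt hn)
    refine ⟨ofMem _ (mem_vonNeumann_of_mem hsucc hω), hsucc, fun z => ?_⟩
    rw [mem_iff_val_mem_val, val_ofMem, Ordinal.toZFSet_add_one, ZFSet.mem_insert_iff, hnx,
      VStructure.ext_iff, or_comm, mem_iff_val_mem_val]

theorem exists_image (ho : ∀ s ∈ V_ o, s.card < o.cof) {F a : VStructure (o + 1)}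
    (ha : SetModel.IsSet a)
    (hF : ∀ x y y', SetModel.PairMem x y F → SetModel.PairMem x y' F → y = y') :
    ∃ b : VStructure (o + 1), SetModel.IsSet b ∧
      ∀ y, y ∈ b ↔ ∃ x, x ∈ a ∧ SetModel.PairMem x y F := by
  have hFV {x y : ZFSet} (h : ZFSet.pair x y ∈ F.val) : x ∈ V_ o ∧ y ∈ V_ o :=
    have h := mem_vonNeumann_of_mem_val h
    ⟨left_mem_vonNeumann_of_pair_mem h, right_mem_vonNeumann_of_pair_mem h⟩
  have hFval {x y y' : ZFSet} (hy : ZFSet.pair x y ∈ F.val) (hy' : ZFSet.pair x y' ∈ F.val) :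
      y = y' :=
    congrArg val <| hF (ofMem x (hFV hy).1) (ofMem y (hFV hy).2) (ofMem y' (hFV hy').2)
      (pairMem_iff.2 hy) (pairMem_iff.2 hy')
  let b := (V_ o).sep fun y => ∃ x ∈ a.val, ZFSet.pair x y ∈ F.val
  choose f hfa hfF using fun y : b => (ZFSet.mem_sep.1 y.2).2
  have hinj : Function.Injective fun y : b => (⟨f y, hfa y⟩ : a.val) := fun y y' hyy' => by
    have heq : f y = f y' := congrArg Subtype.val hyy'
    exact Subtype.ext (hFval (hfF y) (heq ▸ hfF y'))
  have hb : b ∈ V_ o := mem_vonNeumann_of_card_lt_cof ZFSet.sep_subset <|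
    (card_le_card_of_injective hinj).trans_lt (ho _ (isSet_iff.1 ha))
  refine ⟨ofMem b hb, isSet_iff.2 hb, fun y => ?_⟩
  simp only [pairMem_iff]
  rw [exists_mem_iff (q := fun x => ZFSet.pair x y.val ∈ F.val), mem_iff_val_mem_val, val_ofMem,
    ZFSet.mem_sep, and_iff_right_iff_imp]
  rintro ⟨x, -, hxy⟩
  exact (hFV hxy).2

theorem exists_choiceFunction (ho : Order.IsSuccLimit o) {a : VStructure (o + 1)}
    (ha : SetModel.IsSet a) (hne : ∀ x, x ∈ a → ∃ y : VStructure (o + 1), y ∈ x) :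
    ∃ f, SetModel.IsSet f ∧ (∀ p, p ∈ f → ∃ x y, x ∈ a ∧ y ∈ x ∧ SetModel.IsOPair p x y) ∧
      ∀ x, x ∈ a → ∃! y, SetModel.PairMem x y f := by
  rw [isSet_iff] at ha
  have hchoice (x : a.val) : ∃ y : (⋃₀ a.val : ZFSet), y.1 ∈ x.1 := by
    obtain ⟨x, hx⟩ := x
    obtain ⟨x, rfl⟩ := exists_val_eq hx
    obtain ⟨y, hy⟩ := hne x hx
    exact ⟨⟨y.val, ZFSet.mem_sUnion.2 ⟨x.val, hx, hy⟩⟩, hy⟩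
  choose φ hφ using hchoice
  have hUnion := sUnion_mem_vonNeumann ha
  have hf := functionGraph_mem_vonNeumann ho ha hUnion φ
  have hfun : SetModel.IsFun (ofMem _ hf) a (ofMem _ hUnion) := isFun_iff.2 ⟨φ, rfl⟩
  refine ⟨ofMem _ hf, isSet_iff.2 hf, fun p hp => ?_, hfun.2⟩
  obtain ⟨x, y, hx, -, hpxy⟩ := hfun.1 p hp
  have hxyf : ZFSet.pair x.val y.val ∈ functionGraph φ := by
    rwa [← isOPair_iff.1 hpxy]
  obtain ⟨_, hxy⟩ := pair_mem_functionGraph.1 hxyf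
  exact ⟨x, y, hx, mem_iff_val_mem_val.2 (hxy ▸ hφ _), hpxy⟩

theorem satisfiesGBAC (hκ : κ.IsInaccessible) :
    SetModel.SatisfiesGBAC (VStructure (κ.ord + 1)) := by
  have ho := Cardinal.isSuccLimit_ord hκ.aleph0_lt.le
  have hω : Ordinal.omega0 < κ.ord := Cardinal.omega0_lt_ord.2 hκ.aleph0_lt
  have hcof (s : ZFSet) (hs : s ∈ V_ κ.ord) : s.card < κ.ord.cof :=
    hκ.isRegular.cof_ord.symm ▸ card_lt_of_mem_vonNeumann_ord hκ hs
  exact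
    { extensionality := fun _ _ => extensionality
      comprehension := fun φ a => exists_class fun x => φ.Holds (Function.update a 0 x)
      foundation := fun _ => foundation
      pairing := fun _ _ => exists_unorderedPair ho
      union := fun _ => exists_union
      powerset := fun _ => exists_powerset ho
      infinity := exists_inductive hω
      replacement := fun _ _ => exists_image hcof
      choice := fun _ => exists_choiceFunction ho }

end Axioms

end VStructure

theorem mainTheorem4 (κ : Cardinal.{u})
    (hsuper : IsLeast {μ : Cardinal.{u} | IsSupercompact μ} κ)
    (hstrong : IsLeast {μ : Cardinal.{u} | IsStronglyCompact μ} κ) :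
    (SetModel.SatisfiesSWVP (VStructure (κ.ord + 1)) ∧
      ¬ SetModel.SatisfiesExistsStronglyCompact (VStructure (κ.ord + 1))) ∧
    SetModel.SatisfiesGBAC (VStructure (κ.ord + 1)) ∧
    ¬ (∀ (M : Type (u + 1)) [Membership M M],
        SetModel.SatisfiesGBAC M → SetModel.SatisfiesSWVP M →
          SetModel.SatisfiesExistsStronglyCompact M) := by
  have hSWVP := VStructure.satisfiesSWVP hsuper.1
  have hnone := VStructure.not_satisfiesExistsStronglyCompact hstrong
  have hGBAC := VStructure.satisfiesGBAC hstrong.1.isInaccessible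
  exact ⟨⟨hSWVP, hnone⟩, hGBAC, fun h => hnone (h _ hGBAC hSWVP)⟩
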